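/- **Setting.** Let $(\Omega,\mathcal F,\mathbb P)$ be a probability space, $\mathcal G\subset\mathcal F$ a sub-$\sigma$-field, $d\in\mathbb N$ and $p\in[1,\infty)$. Let $\mathcal K(\mathbb R^d)$ be the family of nonempty compact convex subsets of $\mathbb R^d$. For $A,B\in\mathcal K(\mathbb R^d)$ the Hukuhara difference $A\ominus B$ exists if there is $C\in\mathcal K(\mathbb R^d)$ with $A=B+C$ (Minkowski sum); then $A\ominus B:=C$, which is unique. For $\mathcal H\in\{\mathcal F,\mathcal G\}$, a function $X$ from $\Omega$ to the nonempty closed subsets of $\mathbb R^d$ is $\mathcal H$-measurable if $\{\omega: X(\omega)\cap B\neq\emptyset\}\in\mathcal H$ for every closed $B\subset\mathbb R^d$. Let $S^1_{\mathcal H}(X)$ be the set of (classes of) $f\in\mathbb L^1(\Omega,\mathcal H,\mathbb P;\mathbb R^d)$ with $f\in X$ a.s. Let $\mathscr L^p_{\mathcal H}(\Omega,\mathcal K(\mathbb R^d))$ be the set of $\mathcal H$-measurable $X:\Omega\to\mathcal K(\mathbb R^d)$ that are $p$-integrably bounded, i.e. $h(X,\{0\})\le \ell$ a.s. for some $\ell\in\mathbb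 L^p(\Omega,\mathcal H,\mathbb P;\mathbb R_+)$, where $h$ is the Hausdorff distance. As usual, set-valued functions that agree a.s. are identified. For an $\mathcal F$-measurable, nonempty-closed-valued $X$ with $S^1_{\mathcal F}(X)\ne\emptyset$, the conditional expectation $\mathbb E[X|\mathcal G]$ is the (a.s. unique) $\mathcal G$-measurable, nonempty-closed-valued function with $S^1_{\mathcal G}(\mathbb E[X|\mathcal G])\neq\emptyset$ and $$S^1_{\mathcal G}(\mathbb E[X|\mathcal G])=\operatorname{cl}\{\mathbb E[f|\mathcal G]: f\in S^1_{\mathcal F}(X)\},$$ the closure being taken in $\mathbb L^1(\Omega,\mathcal G,\mathbb P;\mathbb R^d)$. **Corollary 3.1.** Let $X_1,X_2\in\mathscr L^p_{\mathcal F}(\Omega,\mathcal K(\mathbb R^d))$ and suppose that $X_1\ominus X_2$ exists, i.e. $X_1(\omega)\ominus X_2(\omega)$ exists for a.e. $\omega$. Then $X_1\ominus X_2\in\mathscr L^p_{\mathcal F}(\Omega,\mathcal K(\mathbb R^d))$ (after modification on a null set), the conditional expectations $\mathbb E[X_1\ominus X_2|\mathcal G]$, $\mathbb E[X_1|\mathcal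 G]$ and $\mathbb E[X_2|\mathcal G]$ exist in $\mathscr L^p_{\mathcal G}(\Omega,\mathcal K(\mathbb R^d))$, and $$\mathbb E[X_1\ominus X_2|\mathcal G]=\mathbb E[X_1|\mathcal G]\ominus\mathbb E[X_2|\mathcal G]\quad\text{a.s.},$$ where in particular the Hukuhara difference on the right exists a.s. -/

import Mathlib

open MeasureTheory
open scoped ENNReal Pointwise

namespace SetValued

section Sets

variable {E : Type*} [NormedAddCommGroup E] [NormedSpace ℝ E]

/-- `A ∈ 𝒦(E)`: the set `A` is nonempty, compact and convex. -/
def IsCompactConvex (A : Set E) : Prop :=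
  A.Nonempty ∧ IsCompact A ∧ Convex ℝ A

/-- `C = A ⊖ B`: for `A, B, C ∈ 𝒦(E)`, the set `C` is the Hukuhara difference of `A` and `B`,
i.e. `A = B + C` (Minkowski sum). -/
def IsHukuharaDiff (A B C : Set E) : Prop :=
  IsCompactConvex A ∧ IsCompactConvex B ∧ IsCompactConvex C ∧ A = B + C

/-- The Hukuhara difference `A ⊖ B` exists. -/
def HukuharaDiffExists (A B : Set E) : Prop :=
  ∃ C : Set E, IsHukuharaDiff A B C

end Sets

section Functions

variable {Ω E : Type*} [NormedAddCommGroup E] [NormedSpace ℝ E]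

/-- (Strong) measurability of a set-valued function with respect to the σ-algebra `m`. -/
def SetMeasurable (m : MeasurableSpace Ω) (F : Ω → Set E) : Prop :=
  ∀ B : Set E, IsClosed B → MeasurableSet[m] {ω | (F ω ∩ B).Nonempty}

/-- `S^p(F)`: the classes `f ∈ L^p(Ω, m, μ; E)` with `f ∈ F` almost everywhere. The σ-algebra
is the one on which `μ` is defined. -/
def selections {m : MeasurableSpace Ω} (μ : Measure Ω) (p : ℝ≥0∞) (F : Ω → Set E) :
    Set (Lp E p μ) :=
  {f | ∀ᵐ ω ∂μ, f ω ∈ F ω}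

/-- `F ∈ 𝒜^p(Ω, 𝒞(E))`: `F` is measurable, has nonempty closed values, and possesses a
`p`-integrable selection. -/
def MemA {m : MeasurableSpace Ω} (μ : Measure Ω) (p : ℝ≥0∞) (F : Ω → Set E) : Prop :=
  SetMeasurable m F ∧ (∀ ω, (F ω).Nonempty ∧ IsClosed (F ω)) ∧ (selections μ p F).Nonempty

/-- `F` is `p`-integrably bounded: `‖F(ω)‖ = h(F(ω), {0}) ≤ ℓ(ω)` almost everywhere for some
`ℓ ∈ L^p(Ω, m, μ; ℝ₊)`, where `h` is the (extended) Hausdorff distance. -/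
def IntegrablyBounded {m : MeasurableSpace Ω} (μ : Measure Ω) (p : ℝ≥0∞) (F : Ω → Set E) :
    Prop :=
  ∃ ℓ : Ω → ℝ, (∀ ω, 0 ≤ ℓ ω) ∧ MemLp ℓ p μ ∧
    ∀ᵐ ω ∂μ, Metric.hausdorffEDist (F ω) {0} ≤ ENNReal.ofReal (ℓ ω)

/-- `F ∈ ℒ^p(Ω, 𝒦(E))`: `F` is measurable, has nonempty compact convex values, and is
`p`-integrably bounded. -/
def MemSetLp {m : MeasurableSpace Ω} (μ : Measure Ω) (p : ℝ≥0∞) (F : Ω → Set E) : Prop :=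
  SetMeasurable m F ∧ (∀ ω, IsCompactConvex (F ω)) ∧ IntegrablyBounded μ p F

/-- `Y` is (a version of) the set-valued conditional expectation `𝔼[X | 𝒢]`: for
`X ∈ 𝒜^1_ℱ(Ω, 𝒞(E))`, it is an element of `𝒜^1_𝒢(Ω, 𝒞(E))` with
`S^1_𝒢(Y) = cl {𝔼[f | 𝒢] : f ∈ S^1(X)}`, the closure being taken in `L^1_𝒢(Ω; E)`, the `L^1`
space of the measure space `(Ω, 𝒢, P)`. -/
def IsSetCondExp [CompleteSpace E] {𝓕 𝓖 : MeasurableSpace Ω} (P : Measure[𝓕] Ω) (h𝓖 : 𝓖 ≤ 𝓕)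
    (X Y : Ω → Set E) : Prop :=
  MemA P 1 X ∧ MemA (P.trim h𝓖) 1 Y ∧
    selections (P.trim h𝓖) 1 Y =
      closure {g : Lp E 1 (P.trim h𝓖) | ∃ f ∈ selections P 1 X, g =ᵐ[P] P[f | 𝓖]}

end Functions

end SetValued

/-! Support functions turn Minkowski addition into addition of real functions, and a compact convex
set is determined by its support function on a countable dense set of directions. The heart of the
proof is the existence of a version of `𝔼[X | 𝓖]` whose support function in each such direction is
the scalar conditional expectation of that of `X` (`MemSetLp.exists_isSetCondExp`). The identity for
the difference is then linearity of scalar conditional expectation.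

That version is the closure of the midpoint-closed set generated by the conditional expectations of
countably many almost maximizing selections of `X`. Midpoints give convexity while keeping
everything countable, measurable and compatible with conditioning. Every `𝔼[f | 𝓖]` satisfies the
defining half-space inequalities. Conversely, a selection of the closure is approximated by a
`𝓖`-measurable choice among the countably many generators, and conditioning commutes with such a
choice.

The difference `X₁ ⊖ X₂` is measurable because its support function is a difference of measurable
functions and measurability of a set-valued map can be read off its support functions. Castaing
representations give the selections, and uniqueness of the conditional expectation. -/

namespace SetValued

/-! ### Support functions of compact convex sets -/

section SupportFunction

variable {E : Type*} [NormedAddCommGroup E] [InnerProductSpace ℝ E]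

/-- The support function of a set. -/
noncomputable def supportFn (K : Set E) (u : E) : ℝ :=
  sSup ((fun x => inner ℝ u x) '' K)

theorem _root_.IsCompact.inner_le_supportFn {K : Set E} (hK : IsCompact K) (u : E) {x : E}
    (hx : x ∈ K) : inner ℝ u x ≤ supportFn K u :=
  le_csSup (hK.image (by fun_prop)).bddAbove (Set.mem_image_of_mem _ hx)

theorem supportFn_le {K : Set E} (hne : K.Nonempty) {u : E} {c : ℝ}
    (h : ∀ x ∈ K, inner ℝ u x ≤ c) : supportFn K u ≤ c := by
  refine csSup_le (hne.image _) ?_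
  rintro _ ⟨x, hx, rfl⟩
  exact h x hx

theorem _root_.IsCompact.exists_inner_eq_supportFn {K : Set E} (hK : IsCompact K)
    (hne : K.Nonempty) (u : E) : ∃ x ∈ K, inner ℝ u x = supportFn K u :=
  (hK.image (f := fun x => inner ℝ u x) (by fun_prop)).sSup_mem (hne.image _)

theorem lt_supportFn_iff {K : Set E} (hK : IsCompact K) (hne : K.Nonempty) {u : E} {c : ℝ} :
    c < supportFn K u ↔ ∃ x ∈ K, c < inner ℝ u x := by
  constructor
  · intro h
    obtain ⟨x, hx, hxu⟩ := hK.exists_inner_eq_supportFn hne u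
    exact ⟨x, hx, hxu ▸ h⟩
  · rintro ⟨x, hx, h⟩
    exact h.trans_le (hK.inner_le_supportFn u hx)

theorem supportFn_add {A B : Set E} (hA : IsCompact A) (hAne : A.Nonempty) (hB : IsCompact B)
    (hBne : B.Nonempty) (u : E) : supportFn (A + B) u = supportFn A u + supportFn B u := by
  apply le_antisymm
  · refine supportFn_le (hAne.add hBne) ?_
    rintro _ ⟨a, ha, b, hb, rfl⟩
    simp only [inner_add_right]
    exact add_le_add (hA.inner_le_supportFn u ha) (hB.inner_le_supportFn u hb)
  · obtain ⟨a, ha, hau⟩ := hA.exists_inner_eq_supportFn hAne u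
    obtain ⟨b, hb, hbu⟩ := hB.exists_inner_eq_supportFn hBne u
    rw [← hau, ← hbu, ← inner_add_right]
    exact (hA.add hB).inner_le_supportFn u (Set.add_mem_add ha hb)

theorem _root_.IsCompact.continuous_supportFn {K : Set E} (hK : IsCompact K) :
    Continuous (supportFn K) :=
  hK.continuous_sSup (f := fun u x => inner ℝ u x) (by fun_prop)

/-- A compact convex set is cut out by the half-spaces given by a dense set of directions. -/
theorem mem_of_forall_inner_le_supportFn [CompleteSpace E] {K : Set E} (hK : IsCompactConvex K)
    {S : Set E} (hS : Dense S) {x : E} (h : ∀ u ∈ S, inner ℝ u x ≤ supportFn K u) : x ∈ K := by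
  -- Both sides are continuous in `u`, so the inequality passes from `S` to its closure.
  have hall : ∀ u, inner ℝ u x ≤ supportFn K u := fun u =>
    (isClosed_le (by fun_prop) hK.2.1.continuous_supportFn).closure_subset_iff.2 h (hS u)
  by_contra hx
  obtain ⟨f, c, hf, hfx⟩ := geometric_hahn_banach_closed_point hK.2.2 hK.2.1.isClosed hx
  have hrep : ∀ y, inner ℝ ((InnerProductSpace.toDual ℝ E).symm f) y = f y := fun y =>
    InnerProductSpace.toDual_symm_apply
  have h1 := hall ((InnerProductSpace.toDual ℝ E).symm f)
  have h2 : supportFn K ((InnerProductSpace.toDual ℝ E).symm f) ≤ c :=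
    supportFn_le hK.1 fun y hy => by rw [hrep]; exact (hf y hy).le
  rw [hrep] at h1
  linarith

theorem eq_of_supportFn_eq [CompleteSpace E] {A B : Set E} (hA : IsCompactConvex A)
    (hB : IsCompactConvex B) {S : Set E} (hS : Dense S)
    (h : ∀ u ∈ S, supportFn A u = supportFn B u) : A = B :=
  Set.Subset.antisymm
    (fun _ hx => mem_of_forall_inner_le_supportFn hB hS fun u hu =>
      h u hu ▸ hA.2.1.inner_le_supportFn u hx)
    (fun _ hx => mem_of_forall_inner_le_supportFn hA hS fun u hu =>
      h u hu ▸ hB.2.1.inner_le_supportFn u hx)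

theorem IsCompactConvex.add {A B : Set E} (hA : IsCompactConvex A) (hB : IsCompactConvex B) :
    IsCompactConvex (A + B) :=
  ⟨hA.1.add hB.1, hA.2.1.add hB.2.1, hA.2.2.add hB.2.2⟩

/-- Separation of a compact convex set from a closed ball by a direction of a dense set. -/
theorem disjoint_closedBall_iff [CompleteSpace E] {K : Set E} (hK : IsCompactConvex K)
    {S : Set E} (hS : Dense S) {x : E} {r : ℝ} (hr : 0 ≤ r) :
    Disjoint K (Metric.closedBall x r) ↔ ∃ u ∈ S, supportFn K u < inner ℝ u x - r * ‖u‖ := by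
  constructor
  · intro hd
    obtain ⟨f, a, b, hfa, hab, hfb⟩ := geometric_hahn_banach_compact_closed hK.2.2 hK.2.1
      (convex_closedBall x r) Metric.isClosed_closedBall hd
    set w := (InnerProductSpace.toDual ℝ E).symm f
    have hrep : ∀ y, inner ℝ w y = f y := fun y => InnerProductSpace.toDual_symm_apply
    have h1 : supportFn K w ≤ a := supportFn_le hK.1 fun y hy => by rw [hrep]; exact (hfa y hy).le
    have h2 : b ≤ inner ℝ w x - r * ‖w‖ := by
      by_cases hw0 : w = 0
      · have := hfb x (Metric.mem_closedBall_self hr)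
        rw [← hrep] at this
        simp only [hw0, inner_zero_left, norm_zero] at this ⊢
        linarith
      · have hn : ‖w‖ ≠ 0 := norm_ne_zero_iff.2 hw0
        -- This is the point of the ball that minimizes the inner product with `w`.
        have hmem : x - (r / ‖w‖) • w ∈ Metric.closedBall x r := by
          rw [mem_closedBall_iff_norm]
          simp [norm_smul, abs_of_nonneg hr, div_mul_cancel₀ _ hn]
        have := hfb _ hmem
        rw [← hrep, inner_sub_right, inner_smul_right, real_inner_self_eq_norm_sq] at this
        have e : r / ‖w‖ * ‖w‖ ^ 2 = r * ‖w‖ := by field_simp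
        linarith
    -- Strict separation survives small changes of direction, so `w` can be moved into `S`.
    have hopen : IsOpen {u : E | supportFn K u < inner ℝ u x - r * ‖u‖} :=
      isOpen_lt hK.2.1.continuous_supportFn (by fun_prop)
    obtain ⟨u, hu, huS⟩ := hS.inter_open_nonempty _ hopen ⟨w, by simp only [Set.mem_ofPred_eq]; linarith⟩
    exact ⟨u, huS, hu⟩
  · rintro ⟨u, -, hu⟩
    rw [Set.disjoint_left]
    intro y hyK hy
    have h1 := hK.2.1.inner_le_supportFn u hyK
    have h2 : inner ℝ u x - inner ℝ u y ≤ r * ‖u‖ := by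
      rw [← inner_sub_right]
      refine (real_inner_le_norm _ _).trans ?_
      rw [mul_comm]
      refine mul_le_mul_of_nonneg_right ?_ (norm_nonneg _)
      rw [norm_sub_rev]
      exact mem_closedBall_iff_norm.1 hy
    linarith

end SupportFunction

/-! ### Hitting open sets versus hitting closed sets -/

section Hit

variable {Ω E : Type*} [NormedAddCommGroup E]

/-- Weak measurability of a set-valued function: the sets of points whose value meets a given
open set are measurable. -/
def HitMeasurable (m : MeasurableSpace Ω) (F : Ω → Set E) : Prop :=
  ∀ U : Set E, IsOpen U → MeasurableSet[m] {ω | (F ω ∩ U).Nonempty}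

theorem SetMeasurable.hitMeasurable {m : MeasurableSpace Ω} {F : Ω → Set E}
    (h : SetMeasurable m F) : HitMeasurable m F := by
  intro U hU
  obtain ⟨B, hB, -, hBU, -⟩ := hU.exists_iUnion_isClosed
  have : {ω | (F ω ∩ U).Nonempty} = ⋃ n, {ω | (F ω ∩ B n).Nonempty} := by
    ext ω
    simp only [← hBU, Set.inter_iUnion, Set.nonempty_iUnion, Set.mem_ofPred_eq, Set.mem_iUnion]
  rw [this]
  exact MeasurableSet.iUnion fun n => h _ (hB n)

/-- A compact set disjoint from a closed `B` is also disjoint from some thickening of `B`, so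
hitting `B` is the same as hitting countably many shrinking open thickenings. -/
theorem HitMeasurable.setMeasurable {m : MeasurableSpace Ω} {F : Ω → Set E}
    (h : HitMeasurable m F) (hF : ∀ ω, IsCompact (F ω)) : SetMeasurable m F := by
  intro B hB
  have : {ω | (F ω ∩ B).Nonempty} =
      ⋂ n : ℕ, {ω | (F ω ∩ Metric.thickening (1 / ((n : ℝ) + 1)) B).Nonempty} := by
    ext ω
    simp only [Set.mem_ofPred_eq, Set.mem_iInter]
    constructor
    · intro hω n
      exact hω.mono (Set.inter_subset_inter_right _
        (Metric.self_subset_thickening (by positivity) _))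
    · intro hω
      by_contra hne
      rw [Set.not_nonempty_iff_eq_empty, ← Set.disjoint_iff_inter_eq_empty] at hne
      obtain ⟨δ, hδ, hd⟩ := hne.exists_thickenings (hF ω) hB
      obtain ⟨n, hn⟩ := exists_nat_one_div_lt hδ
      obtain ⟨x, hxF, hx⟩ := hω n
      exact Set.disjoint_left.1 hd (Metric.self_subset_thickening hδ _ hxF)
        (Metric.thickening_mono hn.le _ hx)
  rw [this]
  exact MeasurableSet.iInter fun n => h _ Metric.isOpen_thickening

end Hit

/-! ### Measurability through support functions -/

section HitSupport

variable {Ω E : Type*} [NormedAddCommGroup E] [InnerProductSpace ℝ E]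

theorem HitMeasurable.measurable_supportFn {m : MeasurableSpace Ω} {F : Ω → Set E}
    (h : HitMeasurable m F) (hF : ∀ ω, IsCompact (F ω)) (hne : ∀ ω, (F ω).Nonempty) (u : E) :
    Measurable[m] fun ω => supportFn (F ω) u := by
  refine measurable_of_Ioi fun c => ?_
  convert h {x | c < inner ℝ u x} (isOpen_lt (by fun_prop) (by fun_prop)) using 1
  ext ω
  exact lt_supportFn_iff (hF ω) (hne ω)

/-- Missing a closed ball is witnessed by a separating direction from a countable dense family. An
open set is a countable union of closed balls. -/
theorem hitMeasurable_of_measurable_supportFn [FiniteDimensional ℝ E] {m : MeasurableSpace Ω}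
    {F : Ω → Set E} (hF : ∀ ω, IsCompactConvex (F ω))
    (h : ∀ u, Measurable[m] fun ω => supportFn (F ω) u) : HitMeasurable m F := by
  have : CompleteSpace E := FiniteDimensional.complete ℝ E
  have : ProperSpace E := FiniteDimensional.proper ℝ E
  have hball : ∀ (x : E) (r : ℝ), 0 ≤ r →
      MeasurableSet[m] {ω | (F ω ∩ Metric.closedBall x r).Nonempty} := by
    intro x r hr
    have : {ω | (F ω ∩ Metric.closedBall x r).Nonempty}ᶜ = ⋃ n : ℕ,
        {ω | supportFn (F ω) (TopologicalSpace.denseSeq E n) <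
          inner ℝ (TopologicalSpace.denseSeq E n) x - r * ‖TopologicalSpace.denseSeq E n‖} := by
      ext ω
      have := disjoint_closedBall_iff (hF ω) (TopologicalSpace.denseRange_denseSeq E) (x := x) hr
      rw [Set.disjoint_iff_inter_eq_empty, ← Set.not_nonempty_iff_eq_empty] at this
      simpa using this
    rw [← MeasurableSet.compl_iff, this]
    exact MeasurableSet.iUnion fun n => measurableSet_lt (h _) measurable_const
  intro U hU
  have : {ω | (F ω ∩ U).Nonempty} = ⋃ (q : ℕ × ℕ) (_ : Metric.closedBall
      (TopologicalSpace.denseSeq E q.1) (1 / ((q.2 : ℝ) + 1)) ⊆ U),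
      {ω | (F ω ∩ Metric.closedBall
        (TopologicalSpace.denseSeq E q.1) (1 / ((q.2 : ℝ) + 1))).Nonempty} := by
    ext ω
    simp only [Set.mem_ofPred_eq, Set.mem_iUnion, exists_prop]
    constructor
    · rintro ⟨y, hyF, hyU⟩
      obtain ⟨ε, hε, hball⟩ := Metric.isOpen_iff.1 hU y hyU
      obtain ⟨k, hk⟩ := exists_nat_one_div_lt (half_pos hε)
      obtain ⟨i, hi⟩ := (TopologicalSpace.denseRange_denseSeq E).exists_dist_lt y
        (ε := 1 / ((k : ℝ) + 1)) (by positivity)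
      refine ⟨(i, k), fun z hz => hball ?_, y, hyF, hi.le⟩
      have h1 : dist z (TopologicalSpace.denseSeq E i) ≤ 1 / ((k : ℝ) + 1) := hz
      rw [dist_comm] at hi
      have := dist_triangle z (TopologicalSpace.denseSeq E i) y
      rw [Metric.mem_ball]
      linarith
    · rintro ⟨q, hq, y, hyF, hy⟩
      exact ⟨y, hyF, hq hy⟩
  rw [this]
  exact MeasurableSet.iUnion fun q => MeasurableSet.iUnion fun _ =>
    hball _ _ (by positivity)

end HitSupport

/-! ### Measurable selections and Castaing representations -/

section Selection

variable {Ω E : Type*} [NormedAddCommGroup E] [SecondCountableTopology E]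

-- One refinement step of the selection theorem: taking the least index of a dense point near `G ω`
-- makes the choice measurable.
open TopologicalSpace in
theorem HitMeasurable.exists_inter_ball {m : MeasurableSpace Ω} {G : Ω → Set E}
    (hG : HitMeasurable m G) (hne : ∀ ω, (G ω).Nonempty) {r : ℝ} (hr : 0 < r) :
    ∃ N : Ω → ℕ, Measurable[m] N ∧
      HitMeasurable m (fun ω => G ω ∩ Metric.ball (denseSeq E (N ω)) r) ∧
      ∀ ω, (G ω ∩ Metric.ball (denseSeq E (N ω)) r).Nonempty := by
  classical
  have hex : ∀ ω, ∃ n, (G ω ∩ Metric.ball (denseSeq E n) r).Nonempty := by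
    intro ω
    obtain ⟨y, hy⟩ := hne ω
    obtain ⟨n, hn⟩ := (denseRange_denseSeq E).exists_dist_lt y hr
    exact ⟨n, y, hy, hn⟩
  have hN : Measurable[m] fun ω => Nat.find (hex ω) :=
    measurable_find hex fun n => hG _ Metric.isOpen_ball
  refine ⟨fun ω => Nat.find (hex ω), hN, fun U hU => ?_, fun ω => Nat.find_spec (hex ω)⟩
  have : {ω | ((G ω ∩ Metric.ball (denseSeq E (Nat.find (hex ω))) r) ∩ U).Nonempty} =
      ⋃ n, ({ω | Nat.find (hex ω) = n} ∩
        {ω | (G ω ∩ (Metric.ball (denseSeq E n) r ∩ U)).Nonempty}) := by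
    ext ω
    simp only [Set.inter_assoc, Set.mem_ofPred_eq, Set.mem_iUnion, Set.mem_inter_iff,
      exists_eq_left']
  rw [this]
  exact MeasurableSet.iUnion fun n =>
    (hN (measurableSet_singleton n)).inter (hG _ (Metric.isOpen_ball.inter hU))

variable [CompleteSpace E] [MeasurableSpace E] [BorelSpace E]

open TopologicalSpace Filter Topology in
/-- A measurable selection theorem (Kuratowski and Ryll-Nardzewski). -/
theorem HitMeasurable.exists_measurable_mem_closure {m : MeasurableSpace Ω} {G : Ω → Set E}
    (hG : HitMeasurable m G) (hne : ∀ ω, (G ω).Nonempty) :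
    ∃ f : Ω → E, Measurable[m] f ∧ ∀ ω, f ω ∈ closure (G ω) := by
  let Good := {H : Ω → Set E // HitMeasurable m H ∧ ∀ ω, (H ω).Nonempty}
  have hpos : ∀ n : ℕ, (0 : ℝ) < (1 / 2) ^ n := fun n => by positivity
  have step : ∀ (H : Good) (n : ℕ), ∃ N : Ω → ℕ, Measurable[m] N ∧
      HitMeasurable m (fun ω => H.1 ω ∩ Metric.ball (denseSeq E (N ω)) ((1 / 2) ^ n)) ∧
      ∀ ω, (H.1 ω ∩ Metric.ball (denseSeq E (N ω)) ((1 / 2) ^ n)).Nonempty :=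
    fun H n => H.2.1.exists_inter_ball H.2.2 (hpos n)
  choose N hNm hNh hNne using step
  -- Nested sets, each cut by a ball of radius `(1 / 2) ^ n`; the selection is the limit of the
  -- centres.
  let H : ℕ → Good := fun n => Nat.rec ⟨G, hG, hne⟩ (fun n K => ⟨_, hNh K n, hNne K n⟩) n
  have hsucc : ∀ n ω, (H (n + 1)).1 ω =
      (H n).1 ω ∩ Metric.ball (denseSeq E (N (H n) n ω)) ((1 / 2) ^ n) := fun n ω => rfl
  have hanti : ∀ ω, Antitone fun n => (H n).1 ω := fun ω =>
    antitone_nat_of_succ_le fun n => by rw [hsucc]; exact Set.inter_subset_left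
  let a : ℕ → Ω → E := fun n ω => denseSeq E (N (H n) n ω)
  have ham : ∀ n, Measurable[m] (a n) := fun n => measurable_from_nat.comp (hNm _ n)
  choose y hy using fun n => (H n).2.2
  have hdist : ∀ ω n k, n < k → dist (y k ω) (a n ω) < (1 / 2) ^ n := by
    intro ω n k hnk
    have h1 : y k ω ∈ (H (n + 1)).1 ω := hanti ω (Nat.succ_le_of_lt hnk) (hy k ω)
    rw [hsucc] at h1
    exact h1.2
  have hcauchy : ∀ ω, ∃ x, Tendsto (fun n => a n ω) atTop (𝓝 x) := by
    intro ω
    -- The constant `2` arises because consecutive centres are both within `(1 / 2) ^ n` of `y (n +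
    -- 2) ω`.
    refine cauchySeq_tendsto_of_complete
      (cauchySeq_of_le_geometric (1 / 2) 2 (by norm_num) fun n => ?_)
    have h1 := hdist ω n (n + 2) (by omega)
    have h2 := hdist ω (n + 1) (n + 2) (by omega)
    have h3 := dist_triangle_left (a n ω) (a (n + 1) ω) (y (n + 2) ω)
    have h4 : ((1 : ℝ) / 2) ^ (n + 1) ≤ (1 / 2) ^ n :=
      pow_le_pow_of_le_one (by norm_num) (by norm_num) (by omega)
    linarith
  choose f hf using hcauchy
  refine ⟨f, measurable_of_tendsto_metrizable ham (tendsto_pi_nhds.2 hf), fun ω => ?_⟩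
  have hy' : Tendsto (fun n => y (n + 1) ω) atTop (𝓝 (f ω)) := by
    refine (tendsto_iff_of_dist ?_).1 (hf ω)
    refine squeeze_zero (fun _ => dist_nonneg) (fun n => ?_)
      (tendsto_pow_atTop_nhds_zero_of_lt_one (r := (1 / 2 : ℝ)) (by norm_num) (by norm_num))
    rw [dist_comm]
    exact (hdist ω n (n + 1) (by omega)).le
  exact mem_closure_of_tendsto hy' (Eventually.of_forall fun n => hanti ω (Nat.zero_le _) (hy _ ω))

open TopologicalSpace in
/-- The Castaing representation of a measurable closed-valued function. -/
theorem HitMeasurable.exists_castaing {m : MeasurableSpace Ω} {F : Ω → Set E}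
    (hF : HitMeasurable m F) (hne : ∀ ω, (F ω).Nonempty) (hcl : ∀ ω, IsClosed (F ω)) :
    ∃ f : ℕ → Ω → E, (∀ n, Measurable[m] (f n)) ∧ (∀ n ω, f n ω ∈ F ω) ∧
      ∀ ω, F ω ⊆ closure (Set.range fun n => f n ω) := by
  classical
  have key : ∀ q : ℕ × ℕ, ∃ f : Ω → E, Measurable[m] f ∧ (∀ ω, f ω ∈ F ω) ∧
      ∀ ω, (F ω ∩ Metric.ball (denseSeq E q.1) (1 / ((q.2 : ℝ) + 1))).Nonempty →
        dist (f ω) (denseSeq E q.1) ≤ 1 / ((q.2 : ℝ) + 1) := by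
    intro q
    set B := Metric.ball (denseSeq E q.1) (1 / ((q.2 : ℝ) + 1))
    -- Falling back to `F ω` where the ball is missed keeps the values nonempty, so a selection
    -- exists on all of `Ω`.
    let G : Ω → Set E := fun ω => if (F ω ∩ B).Nonempty then F ω ∩ B else F ω
    have hGF : ∀ ω, G ω ⊆ F ω := fun ω => by
      by_cases h : (F ω ∩ B).Nonempty <;> simp [G, h]
    have hGh : HitMeasurable m G := by
      intro U hU
      have : {ω | (G ω ∩ U).Nonempty} = {ω | (F ω ∩ (B ∩ U)).Nonempty} ∪
          ({ω | (F ω ∩ B).Nonempty}ᶜ ∩ {ω | (F ω ∩ U).Nonempty}) := by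
        ext ω
        by_cases h : (F ω ∩ B).Nonempty
        · simp [G, h, Set.inter_assoc]
        · have h' : ¬ (F ω ∩ (B ∩ U)).Nonempty := fun h2 =>
            h (h2.mono (Set.inter_subset_inter_right _ Set.inter_subset_left))
          simp [G, h, h']
      rw [this]
      exact (hF _ (Metric.isOpen_ball.inter hU)).union
        ((hF _ Metric.isOpen_ball).compl.inter (hF _ hU))
    have hGne : ∀ ω, (G ω).Nonempty := fun ω => by
      by_cases h : (F ω ∩ B).Nonempty
      · simp [G, h]
      · simpa [G, h] using hne ω
    obtain ⟨f, hfm, hf⟩ := hGh.exists_measurable_mem_closure hGne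
    refine ⟨f, hfm, fun ω => (hcl ω).closure_subset_iff.2 (hGF ω) (hf ω), fun ω h => ?_⟩
    have h1 : G ω ⊆ Metric.closedBall (denseSeq E q.1) (1 / ((q.2 : ℝ) + 1)) := by
      simp only [G, h, if_true]
      exact Set.inter_subset_right.trans Metric.ball_subset_closedBall
    exact Metric.isClosed_closedBall.closure_subset_iff.2 h1 (hf ω)
  choose f hfm hfF hfd using key
  refine ⟨fun n => f n.unpair, fun n => hfm _, fun n ω => hfF _ ω, fun ω x hx => ?_⟩
  rw [Metric.mem_closure_range_iff]
  intro ε hε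
  obtain ⟨k, hk⟩ := exists_nat_one_div_lt (half_pos hε)
  obtain ⟨i, hi⟩ := (denseRange_denseSeq E).exists_dist_lt x
    (ε := 1 / ((k : ℝ) + 1)) (by positivity)
  refine ⟨Nat.pair i k, ?_⟩
  have h1 := hfd (i, k) ω ⟨x, hx, hi⟩
  have h2 := dist_triangle_right x (f (i, k) ω) (denseSeq E i)
  simp only [Nat.unpair_pair]
  simp only at h1
  linarith

end Selection

/-! ### Hausdorff distance to zero as a norm bound -/

section Bounds

variable {E : Type*} [NormedAddCommGroup E]

theorem norm_le_of_hausdorffEDist_le {A : Set E} {c : ℝ} (hc : 0 ≤ c)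
    (h : Metric.hausdorffEDist A {0} ≤ ENNReal.ofReal c) {x : E} (hx : x ∈ A) : ‖x‖ ≤ c := by
  have := (Metric.infEDist_le_hausdorffEDist_of_mem hx).trans h
  rw [Metric.infEDist_singleton, edist_zero_right, ← ofReal_norm] at this
  exact (ENNReal.ofReal_le_ofReal_iff hc).1 this

theorem hausdorffEDist_le_of_norm_le {A : Set E} (hne : A.Nonempty) {c : ℝ}
    (h : ∀ x ∈ A, ‖x‖ ≤ c) : Metric.hausdorffEDist A {0} ≤ ENNReal.ofReal c := by
  have key : ∀ x ∈ A, edist x 0 ≤ ENNReal.ofReal c := fun x hx => by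
    rw [edist_zero_right, ← ofReal_norm]
    exact ENNReal.ofReal_le_ofReal (h x hx)
  refine Metric.hausdorffEDist_le_of_infEDist (fun x hx => ?_) (fun x hx => ?_)
  · rw [Metric.infEDist_singleton]
    exact key x hx
  · obtain ⟨y, hy⟩ := hne
    rw [Set.mem_singleton_iff] at hx
    subst hx
    refine (Metric.infEDist_le_edist_of_mem hy).trans ?_
    rw [edist_comm]
    exact key y hy

theorem IntegrablyBounded.exists_norm_le {Ω : Type*} {m : MeasurableSpace Ω} {μ : Measure Ω}
    {p : ℝ≥0∞} {F : Ω → Set E} (h : IntegrablyBounded μ p F) :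
    ∃ ℓ : Ω → ℝ, (∀ ω, 0 ≤ ℓ ω) ∧ MemLp ℓ p μ ∧ ∀ᵐ ω ∂μ, ∀ x ∈ F ω, ‖x‖ ≤ ℓ ω := by
  obtain ⟨ℓ, hℓ, hLp, hF⟩ := h
  refine ⟨ℓ, hℓ, hLp, ?_⟩
  filter_upwards [hF] with ω hω x hx
  exact norm_le_of_hausdorffEDist_le (hℓ ω) hω hx

end Bounds

/-! ### Convexity from midpoints -/

section Midpoint

variable {E : Type*} [NormedAddCommGroup E] [NormedSpace ℝ E]

/-- If a parameter `t` of a segment is missing, the nearest parameters `a < t < b` present on each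
side exist by compactness. Their midpoint is present and nearer to `t` on one side, a contradiction.
-/
theorem convex_of_isClosed_of_midpoint_mem {K : Set E} (hK : IsClosed K)
    (h : ∀ x ∈ K, ∀ y ∈ K, midpoint ℝ x y ∈ K) : Convex ℝ K := by
  rw [convex_iff_segment_subset]
  intro x hx y hy
  rw [segment_eq_image_lineMap]
  rintro _ ⟨t, ht, rfl⟩
  set T : Set ℝ := (AffineMap.lineMap x y : ℝ →ᵃ[ℝ] E) ⁻¹' K with hT
  have hTc : IsClosed T := hK.preimage AffineMap.lineMap_continuous
  have hTm : ∀ a ∈ T, ∀ b ∈ T, midpoint ℝ a b ∈ T := by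
    intro a ha b hb
    simp only [hT, Set.mem_preimage, AffineMap.map_midpoint] at ha hb ⊢
    exact h _ ha _ hb
  by_contra hn
  have hnT : t ∉ T := hn
  have h0 : (0 : ℝ) ∈ T ∩ Set.Icc 0 t := ⟨by simpa [hT] using hx, le_refl _, ht.1⟩
  have h1 : (1 : ℝ) ∈ T ∩ Set.Icc t 1 := ⟨by simpa [hT] using hy, ht.2, le_refl _⟩
  have hc0 : IsCompact (T ∩ Set.Icc 0 t) := isCompact_Icc.inter_left hTc
  have hc1 : IsCompact (T ∩ Set.Icc t 1) := isCompact_Icc.inter_left hTc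
  set a := sSup (T ∩ Set.Icc 0 t)
  set b := sInf (T ∩ Set.Icc t 1)
  have ha : a ∈ T ∩ Set.Icc 0 t := hc0.sSup_mem ⟨_, h0⟩
  have hb : b ∈ T ∩ Set.Icc t 1 := hc1.sInf_mem ⟨_, h1⟩
  have hat : a < t := lt_of_le_of_ne ha.2.2 fun e => hnT (e ▸ ha.1)
  have htb : t < b := lt_of_le_of_ne hb.2.1 fun e => hnT (e ▸ hb.1)
  have hm := hTm a ha.1 b hb.1
  have hmid : midpoint ℝ a b = (a + b) / 2 := by
    rw [midpoint_eq_smul_add, smul_eq_mul, invOf_eq_inv]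
    ring
  rw [hmid] at hm
  rcases le_total ((a + b) / 2) t with hle | hle
  · have : (a + b) / 2 ≤ a := le_csSup hc0.bddAbove ⟨hm, by linarith [ha.2.1], hle⟩
    linarith
  · have : b ≤ (a + b) / 2 := csInf_le hc1.bddBelow ⟨hm, hle, by linarith [hb.2.2]⟩
    linarith

/-- The points obtained from a sequence by taking midpoints `n` times. -/
noncomputable def midpointIter (e : ℕ → E) : ℕ → ℕ → E
  | 0, i => e i
  | n + 1, i => midpoint ℝ (midpointIter e n i.unpair.1) (midpointIter e n i.unpair.2)

/-- An enumeration of the midpoint-closed set generated by a sequence. -/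
noncomputable def midpointSeq (e : ℕ → E) (n : ℕ) : E :=
  midpointIter e n.unpair.1 n.unpair.2

theorem midpointIter_mem {e : ℕ → E} {K : Set E} (hK : Convex ℝ K) (he : ∀ i, e i ∈ K) (n i : ℕ) :
    midpointIter e n i ∈ K := by
  induction n generalizing i with
  | zero => exact he i
  | succ n ih => exact hK.midpoint_mem (ih _) (ih _)

theorem midpointSeq_mem {e : ℕ → E} {K : Set E} (hK : Convex ℝ K) (he : ∀ i, e i ∈ K) (n : ℕ) :
    midpointSeq e n ∈ K :=
  midpointIter_mem hK he _ _

/-- A point is its own midpoint, so depth can be raised freely; two points are thus brought to a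
common depth before their midpoint is formed. -/
theorem exists_midpointIter_add (e : ℕ → E) (n i k : ℕ) :
    ∃ j, midpointIter e (n + k) j = midpointIter e n i := by
  induction k with
  | zero => exact ⟨i, rfl⟩
  | succ k ih =>
    obtain ⟨j, hj⟩ := ih
    exact ⟨Nat.pair j j, by simp [midpointIter, hj]⟩

theorem mem_range_midpointSeq (e : ℕ → E) (i : ℕ) : e i ∈ Set.range (midpointSeq e) :=
  ⟨Nat.pair 0 i, by simp [midpointSeq, midpointIter]⟩

theorem midpoint_mem_range_midpointSeq (e : ℕ → E) {x y : E} (hx : x ∈ Set.range (midpointSeq e))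
    (hy : y ∈ Set.range (midpointSeq e)) : midpoint ℝ x y ∈ Set.range (midpointSeq e) := by
  obtain ⟨a, rfl⟩ := hx
  obtain ⟨b, rfl⟩ := hy
  obtain ⟨i, hi⟩ := exists_midpointIter_add e a.unpair.1 a.unpair.2 b.unpair.1
  obtain ⟨j, hj⟩ := exists_midpointIter_add e b.unpair.1 b.unpair.2 a.unpair.1
  rw [add_comm] at hj
  exact ⟨Nat.pair (a.unpair.1 + b.unpair.1 + 1) (Nat.pair i j), by
    simp [midpointSeq, midpointIter, hi, hj]⟩

theorem convex_closure_range_midpointSeq (e : ℕ → E) :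
    Convex ℝ (closure (Set.range (midpointSeq e))) := by
  refine convex_of_isClosed_of_midpoint_mem isClosed_closure fun x hx y hy => ?_
  exact map_mem_closure₂ (f := fun a b : E => midpoint ℝ a b)
    (by simp only [midpoint_eq_smul_add]; fun_prop) hx hy
    fun a ha b hb => midpoint_mem_range_midpointSeq e ha hb

end Midpoint

/-! ### Measurability of countably generated sets -/

section Measurability

theorem measurable_apply_nat {Ω E : Type*} [MeasurableSpace E] {m : MeasurableSpace Ω} {f : ℕ → Ω → E} {N : Ω → ℕ}
    (hf : ∀ n, Measurable[m] (f n)) (hN : Measurable[m] N) :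
    Measurable[m] fun ω => f (N ω) ω :=
  (measurable_from_prod_countable_right (f := fun q : ℕ × Ω => f q.1 q.2) hf).comp
    (hN.prodMk measurable_id)

variable {Ω E : Type*} [NormedAddCommGroup E] [MeasurableSpace E] [BorelSpace E]

theorem hitMeasurable_closure_range {m : MeasurableSpace Ω} {g : ℕ → Ω → E}
    (hg : ∀ n, Measurable[m] (g n)) :
    HitMeasurable m fun ω => closure (Set.range fun n => g n ω) := by
  intro U hU
  have : {ω | (closure (Set.range fun n => g n ω) ∩ U).Nonempty} = ⋃ n, g n ⁻¹' U := by
    ext ω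
    simp only [Set.mem_ofPred_eq, Set.mem_iUnion, Set.mem_preimage]
    rw [closure_inter_open_nonempty_iff hU]
    constructor
    · rintro ⟨_, ⟨n, rfl⟩, h⟩
      exact ⟨n, h⟩
    · rintro ⟨n, h⟩
      exact ⟨_, ⟨n, rfl⟩, h⟩
  rw [this]
  exact MeasurableSet.iUnion fun n => hg n hU.measurableSet

variable [NormedSpace ℝ E] [SecondCountableTopology E]

theorem measurable_midpointSeq {m : MeasurableSpace Ω} {e : ℕ → Ω → E}
    (he : ∀ i, Measurable[m] (e i)) (n : ℕ) :
    Measurable[m] fun ω => midpointSeq (fun i => e i ω) n := by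
  have : ∀ n i, Measurable[m] fun ω => midpointIter (fun i => e i ω) n i := by
    intro n
    induction n with
    | zero => exact he
    | succ n ih =>
      intro i
      simp only [midpointIter, midpoint_eq_smul_add]
      exact ((ih _).add (ih _)).const_smul _
  exact this _ _

end Measurability

/-! ### Conditional expectations and the trimmed measure -/

section CondExp

variable {Ω E : Type*} {𝓕 𝓖 : MeasurableSpace Ω} {P : Measure[𝓕] Ω} [NormedAddCommGroup E]

theorem ae_trim_of_ae (h𝓖 : 𝓖 ≤ 𝓕) {q : Ω → Prop} (hq : MeasurableSet[𝓖] {ω | q ω})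
    (h : ∀ᵐ ω ∂P, q ω) : ∀ᵐ ω ∂(P.trim h𝓖), q ω := by
  rw [ae_iff] at h ⊢
  rwa [trim_measurableSet_eq h𝓖]
  exact hq.compl

theorem _root_.MeasureTheory.MemLp.trim_of_stronglyMeasurable (h𝓖 : 𝓖 ≤ 𝓕) {f : Ω → E}
    {p : ℝ≥0∞} (h : MemLp f p P) (hf : StronglyMeasurable[𝓖] f) : MemLp f p (P.trim h𝓖) :=
  ⟨hf.aestronglyMeasurable, by rw [eLpNorm_trim h𝓖 hf]; exact h.2⟩

theorem isProbabilityMeasure_trim [IsProbabilityMeasure P] (h𝓖 : 𝓖 ≤ 𝓕) :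
    IsProbabilityMeasure (P.trim h𝓖) :=
  ⟨by rw [trim_measurableSet_eq h𝓖 MeasurableSet.univ]; exact measure_univ⟩

variable [NormedSpace ℝ E] [CompleteSpace E]

/-- Conditional expectation is local: on the `𝓖`-event `N = n` the two integrands agree, and
indicators of `𝓖`-events pull out. -/
theorem condExp_apply_nat_ae_eq {f : ℕ → Ω → E} {N : Ω → ℕ} (hN : Measurable[𝓖] N)
    (hf : ∀ n, Integrable (f n) P) (hfN : Integrable (fun ω => f (N ω) ω) P) :
    P[fun ω => f (N ω) ω | 𝓖] =ᵐ[P] fun ω => P[f (N ω) | 𝓖] ω := by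
  have key : ∀ n, ∀ᵐ ω ∂P, N ω = n → P[fun ω => f (N ω) ω | 𝓖] ω = P[f n | 𝓖] ω := by
    intro n
    have hs : MeasurableSet[𝓖] (N ⁻¹' {n}) := hN (measurableSet_singleton n)
    have heq : (N ⁻¹' {n}).indicator (fun ω => f (N ω) ω) = (N ⁻¹' {n}).indicator (f n) := by
      ext ω
      by_cases h : N ω = n <;> simp [Set.indicator, h]
    have h1 := condExp_indicator hfN hs
    have h2 := condExp_indicator (hf n) hs
    rw [heq] at h1
    filter_upwards [h1, h2] with ω h1 h2 hω
    have hmem : ω ∈ N ⁻¹' {n} := hω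
    rw [h1, Set.indicator_of_mem hmem, Set.indicator_of_mem hmem] at h2
    exact h2
  filter_upwards [ae_all_iff.2 key] with ω hω
  exact hω _ rfl

theorem condExp_midpointSeq_ae_eq {f e : ℕ → Ω → E} (hf : ∀ i, Integrable (f i) P)
    (he : ∀ i, e i =ᵐ[P] P[f i | 𝓖]) (n : ℕ) :
    (fun ω => midpointSeq (fun i => e i ω) n) =ᵐ[P]
      P[fun ω => midpointSeq (fun i => f i ω) n | 𝓖] := by
  have : ∀ n i, Integrable (fun ω => midpointIter (fun i => f i ω) n i) P ∧
      (fun ω => midpointIter (fun i => e i ω) n i) =ᵐ[P]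
        P[fun ω => midpointIter (fun i => f i ω) n i | 𝓖] := by
    intro n
    induction n with
    | zero => exact fun i => ⟨hf i, he i⟩
    | succ n ih =>
      intro i
      simp only [midpointIter, midpoint_eq_smul_add]
      obtain ⟨hi1, h1⟩ := ih i.unpair.1
      obtain ⟨hi2, h2⟩ := ih i.unpair.2
      refine ⟨(hi1.add hi2).smul _, ?_⟩
      refine Filter.EventuallyEq.trans ?_ (condExp_smul (⅟2 : ℝ)
        ((fun ω => midpointIter (fun i => f i ω) n i.unpair.1) +
          (fun ω => midpointIter (fun i => f i ω) n i.unpair.2)) 𝓖).symm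
      filter_upwards [h1, h2, condExp_add hi1 hi2 𝓖] with ω h1 h2 h3
      simp only [Pi.smul_apply, h3, Pi.add_apply, h1, h2]
  exact (this _ _).2

end CondExp

/-! ### The set of integrable selections -/

section Selections

variable {Ω E : Type*} {m : MeasurableSpace Ω} {μ : Measure Ω} [NormedAddCommGroup E]

-- A sequence converging in `Lp` has a subsequence converging almost everywhere, and the values of
-- `F` are closed.
open Filter Topology in
theorem isClosed_selections {p : ℝ≥0∞} [Fact (1 ≤ p)] {F : Ω → Set E}
    (hF : ∀ ω, IsClosed (F ω)) : IsClosed (selections μ p F) := by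
  refine IsSeqClosed.isClosed fun f g hf hfg => ?_
  obtain ⟨ns, -, hns⟩ := (tendstoInMeasure_of_tendsto_Lp hfg).exists_seq_tendsto_ae
  have hmem : ∀ᵐ ω ∂μ, ∀ n, f n ω ∈ F ω := ae_all_iff.2 hf
  filter_upwards [hns, hmem] with ω h1 h2
  exact (hF ω).mem_of_tendsto h1 (Eventually.of_forall fun n => h2 _)

theorem toLp_mem_selections {p : ℝ≥0∞} {F : Ω → Set E} {f : Ω → E} (hf : MemLp f p μ)
    (hF : ∀ᵐ ω ∂μ, f ω ∈ F ω) : hf.toLp f ∈ selections μ p F := by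
  filter_upwards [hF, hf.coeFn_toLp] with ω h1 h2
  rwa [h2]

end Selections

/-! ### Selections determine the set-valued map -/

section Uniqueness

variable {Ω E : Type*} {m : MeasurableSpace Ω} {μ : Measure Ω} [NormedAddCommGroup E]
  [SecondCountableTopology E] [CompleteSpace E] [MeasurableSpace E] [BorelSpace E]

theorem MemA.ae_subset_of_selections_subset [IsFiniteMeasure μ] {p : ℝ≥0∞} {F G : Ω → Set E}
    (hF : MemA μ p F) (hG : ∀ ω, IsClosed (G ω))
    (h : selections μ p F ⊆ selections μ p G) : ∀ᵐ ω ∂μ, F ω ⊆ G ω := by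
  obtain ⟨hFm, hFc, g, hg⟩ := hF
  obtain ⟨f, hfm, hfF, hfd⟩ := hFm.hitMeasurable.exists_castaing
    (fun ω => (hFc ω).1) fun ω => (hFc ω).2
  have key : ∀ n k : ℕ, ∀ᵐ ω ∂μ, ‖f n ω‖ ≤ k → f n ω ∈ G ω := by
    intro n k
    set s : Set Ω := {ω | ‖f n ω‖ ≤ k}
    have hsm : MeasurableSet s := measurableSet_le (hfm n).norm measurable_const
    classical
    -- The Castaing function `f n` need not lie in `Lp`; it is kept where its norm is at most `k`
    -- and replaced by the given selection `g` elsewhere.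
    have hLp : MemLp (s.piecewise (f n) g) p μ := by
      refine MemLp.piecewise hsm ?_ ((Lp.memLp g).restrict _)
      refine MemLp.of_bound (hfm n).aestronglyMeasurable k ?_
      exact (ae_restrict_iff' hsm).2 (Filter.Eventually.of_forall fun ω hω => hω)
    have hmem : ∀ᵐ ω ∂μ, s.piecewise (f n) g ω ∈ F ω := by
      filter_upwards [hg] with ω hω
      by_cases hωs : ω ∈ s
      · simpa [hωs] using hfF n ω
      · simpa [hωs] using hω
    have := h (toLp_mem_selections hLp hmem)
    filter_upwards [this, hLp.coeFn_toLp] with ω h1 h2 hω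
    have hωs : ω ∈ s := hω
    rw [h2] at h1
    simpa [hωs] using h1
  filter_upwards [ae_all_iff.2 fun n => ae_all_iff.2 (key n)] with ω hω
  refine (hfd ω).trans ((hG ω).closure_subset_iff.2 ?_)
  rintro _ ⟨n, rfl⟩
  obtain ⟨k, hk⟩ := exists_nat_ge ‖f n ω‖
  exact hω n k hk

theorem MemA.ae_eq_of_selections_eq [IsFiniteMeasure μ] {p : ℝ≥0∞} {F G : Ω → Set E}
    (hF : MemA μ p F) (hG : MemA μ p G) (h : selections μ p F = selections μ p G) :
    ∀ᵐ ω ∂μ, F ω = G ω := by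
  filter_upwards [hF.ae_subset_of_selections_subset (fun ω => (hG.2.1 ω).2) h.subset,
    hG.ae_subset_of_selections_subset (fun ω => (hF.2.1 ω).2) h.symm.subset] with ω h1 h2
  exact h1.antisymm h2

end Uniqueness

/-! ### Construction of the set-valued conditional expectation -/

section Existence

variable {Ω E : Type*} [NormedAddCommGroup E] [InnerProductSpace ℝ E]

theorem MemSetLp.measurable_supportFn {m : MeasurableSpace Ω} {μ : Measure Ω} {p : ℝ≥0∞}
    {X : Ω → Set E} (hX : MemSetLp μ p X) (u : E) : Measurable fun ω => supportFn (X ω) u :=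
  hX.1.hitMeasurable.measurable_supportFn (fun ω => (hX.2.1 ω).2.1) (fun ω => (hX.2.1 ω).1) u

theorem MemSetLp.integrable_supportFn {m : MeasurableSpace Ω} {μ : Measure Ω} [IsFiniteMeasure μ]
    {p : ℝ≥0∞} (hp : 1 ≤ p) {X : Ω → Set E} (hX : MemSetLp μ p X) (u : E) :
    Integrable (fun ω => supportFn (X ω) u) μ := by
  obtain ⟨ℓ, -, hℓp, hXℓ⟩ := hX.2.2.exists_norm_le
  refine ((hℓp.integrable hp).const_mul ‖u‖).mono' (hX.measurable_supportFn u).aestronglyMeasurable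
    ?_
  filter_upwards [hXℓ] with ω hω
  obtain ⟨x, hx, hxu⟩ := (hX.2.1 ω).2.1.exists_inner_eq_supportFn (hX.2.1 ω).1 u
  rw [← hxu]
  exact (norm_inner_le_norm u x).trans (mul_le_mul_of_nonneg_left (hω x hx) (norm_nonneg u))

variable [FiniteDimensional ℝ E]

variable {𝓕 𝓖 : MeasurableSpace Ω} {P : Measure[𝓕] Ω}

theorem condExp_inner_ae_eq {f : Ω → E} (hf : Integrable f P) (u : E) :
    (fun ω => inner ℝ u (P[f | 𝓖] ω)) =ᵐ[P] P[fun ω => inner ℝ u (f ω) | 𝓖] := by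
  have : CompleteSpace E := FiniteDimensional.complete ℝ E
  exact (innerSL ℝ u).comp_condExp_comm hf

variable [MeasurableSpace E] [BorelSpace E]

/-- A measurable selection which almost attains the support function in a given direction. -/
theorem SetMeasurable.exists_selection_supportFn_lt {m : MeasurableSpace Ω} {X : Ω → Set E}
    (hX : SetMeasurable m X) (hc : ∀ ω, IsCompactConvex (X ω)) (u : E) {ε : ℝ} (hε : 0 < ε) :
    ∃ f : Ω → E, Measurable[m] f ∧ (∀ ω, f ω ∈ X ω) ∧
      ∀ ω, supportFn (X ω) u - ε < inner ℝ u (f ω) := by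
  classical
  have : CompleteSpace E := FiniteDimensional.complete ℝ E
  have : ProperSpace E := FiniteDimensional.proper ℝ E
  obtain ⟨x, hxm, hxX, hxd⟩ := hX.hitMeasurable.exists_castaing
    (fun ω => (hc ω).1) fun ω => (hc ω).2.1.isClosed
  have hs := hX.hitMeasurable.measurable_supportFn (fun ω => (hc ω).2.1) (fun ω => (hc ω).1) u
  have hex : ∀ ω, ∃ n, supportFn (X ω) u - ε < inner ℝ u (x n ω) := by
    intro ω
    obtain ⟨y, hy, hyu⟩ := (hc ω).2.1.exists_inner_eq_supportFn (hc ω).1 u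
    have hopen : IsOpen {z : E | supportFn (X ω) u - ε < inner ℝ u z} :=
      isOpen_lt (by fun_prop) (by fun_prop)
    obtain ⟨_, hz, n, rfl⟩ := mem_closure_iff.1 (hxd ω hy) _ hopen
      (by simp only [Set.mem_ofPred_eq, hyu]; linarith)
    exact ⟨n, hz⟩
  refine ⟨fun ω => x (Nat.find (hex ω)) ω, measurable_apply_nat hxm ?_, fun ω => hxX _ _,
    fun ω => Nat.find_spec (hex ω)⟩
  exact measurable_find hex fun n =>
    measurableSet_lt (hs.sub_const ε) (by
      have := hxm n
      fun_prop)

/-- The conditional expectation of an integrably bounded random compact convex set, together with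
its support function in countably many directions. -/
theorem MemSetLp.exists_isSetCondExp [IsProbabilityMeasure P] (h𝓖 : 𝓖 ≤ 𝓕) {p : ℝ≥0∞}
    (hp : 1 ≤ p) {X : Ω → Set E} (hX : MemSetLp P p X) :
    ∃ Y : Ω → Set E, MemSetLp (P.trim h𝓖) p Y ∧ IsSetCondExp P h𝓖 X Y ∧
      ∀ a : ℕ, (fun ω => supportFn (Y ω) (TopologicalSpace.denseSeq E a)) =ᵐ[P]
        P[fun ω => supportFn (X ω) (TopologicalSpace.denseSeq E a) | 𝓖] := by
  classical
  have : CompleteSpace E := FiniteDimensional.complete ℝ E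
  have : ProperSpace E := FiniteDimensional.proper ℝ E
  have := isProbabilityMeasure_trim (P := P) h𝓖
  obtain ⟨hXm, hXc, hXb⟩ := id hX
  obtain ⟨ℓ, -, hℓp, hXℓ⟩ := hXb.exists_norm_le
  have hℓ : Integrable ℓ P := hℓp.integrable hp
  set v : ℕ → E := TopologicalSpace.denseSeq E
  have hvd : Dense (Set.range v) := TopologicalSpace.denseRange_denseSeq E
  -- integrability of selections and of the support function
  have hint : ∀ f : Ω → E, AEStronglyMeasurable[𝓕] f P → (∀ᵐ ω ∂P, f ω ∈ X ω) → Integrable f P := by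
    intro f hf hfX
    refine hℓ.mono' hf ?_
    filter_upwards [hfX, hXℓ] with ω h1 h2
    exact h2 _ h1
  have hsint := fun u => MemSetLp.integrable_supportFn hp hX u
  have hupper : ∀ f : Ω → E, AEStronglyMeasurable[𝓕] f P → (∀ᵐ ω ∂P, f ω ∈ X ω) → ∀ u,
      ∀ᵐ ω ∂P, inner ℝ u (P[f | 𝓖] ω) ≤ P[fun ω => supportFn (X ω) u | 𝓖] ω := by
    intro f hf hfX u
    have hfi := hint f hf hfX
    have hle : (fun ω => inner ℝ u (f ω)) ≤ᵐ[P] fun ω => supportFn (X ω) u := by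
      filter_upwards [hfX] with ω hω
      exact (hXc ω).2.1.inner_le_supportFn u hω
    filter_upwards [condExp_inner_ae_eq (𝓖 := 𝓖) hfi u,
      condExp_mono (m := 𝓖) (hfi.const_inner u) (hsint u) hle] with ω h1 h2
    exact h1.trans_le h2
  -- almost maximizing selections
  have hsel := fun i : ℕ => hXm.exists_selection_supportFn_lt hXc (v i.unpair.1)
    (ε := 1 / ((i.unpair.2 : ℝ) + 1)) (by positivity)
  choose f hfm hfX hfs using hsel
  have hfsm : ∀ i, AEStronglyMeasurable[𝓕] (f i) P := fun i => (hfm i).aestronglyMeasurable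
  have hfi : ∀ i, Integrable (f i) P := fun i =>
    hint _ (hfsm i) (Filter.Eventually.of_forall (hfX i))
  set M : Ω → ℝ := P[ℓ | 𝓖]
  have hMm : StronglyMeasurable[𝓖] M := stronglyMeasurable_condExp
  -- Setting the generators to zero off this full-measure `𝓖`-event makes `Y ω` bounded, hence
  -- compact, for every `ω`.
  set A : Set Ω := {ω | ∀ i, ‖P[f i | 𝓖] ω‖ ≤ M ω} with hA
  have hAm : MeasurableSet[𝓖] A := by
    have : A = ⋂ i, {ω | ‖P[f i | 𝓖] ω‖ ≤ M ω} := by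
      ext ω
      simp [hA]
    rw [this]
    exact MeasurableSet.iInter fun i =>
      measurableSet_le stronglyMeasurable_condExp.norm.measurable hMm.measurable
  have hAae : ∀ᵐ ω ∂P, ω ∈ A := by
    refine ae_all_iff.2 fun i => ?_
    have hle : (fun ω => ‖f i ω‖) ≤ᵐ[P] ℓ := by
      filter_upwards [hXℓ] with ω hω
      exact hω _ (hfX i ω)
    filter_upwards [norm_condExp_le (m := 𝓖) (μ := P) (f i),
      condExp_mono (m := 𝓖) (hfi i).norm hℓ hle] with ω h1 h2
    exact h1.trans h2
  set e : ℕ → Ω → E := fun i => A.indicator (P[f i | 𝓖]) with he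
  have hem : ∀ i, Measurable[𝓖] (e i) := fun i =>
    stronglyMeasurable_condExp.measurable.indicator hAm
  have heae : ∀ i, e i =ᵐ[P] P[f i | 𝓖] := by
    intro i
    filter_upwards [hAae] with ω hω
    simp [he, hω]
  -- The absolute value matters: off `A` the chosen version `M` may be negative.
  have heM : ∀ ω i, e i ω ∈ Metric.closedBall (0 : E) |M ω| := by
    intro ω i
    rw [mem_closedBall_zero_iff]
    by_cases hω : ω ∈ A
    · simpa [he, hω] using (hω i).trans (le_abs_self _)
    · simp [he, hω]
  -- The same midpoint recipes are applied to `e` and to `f`, so `g n` is a version of `𝔼[F n | 𝓖]`,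
  -- and `F n` selects from `X` by convexity.
  set g : ℕ → Ω → E := fun n ω => midpointSeq (fun i => e i ω) n with hg
  set F : ℕ → Ω → E := fun n ω => midpointSeq (fun i => f i ω) n
  have hgm : ∀ n, Measurable[𝓖] (g n) := measurable_midpointSeq hem
  have hFm : ∀ n, Measurable[𝓕] (F n) := measurable_midpointSeq hfm
  have hFX : ∀ n ω, F n ω ∈ X ω := fun n ω => midpointSeq_mem (hXc ω).2.2 (fun i => hfX i ω) n
  have hFi : ∀ n, Integrable (F n) P := fun n =>
    hint _ (hFm n).aestronglyMeasurable (Filter.Eventually.of_forall (hFX n))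
  have hgF : ∀ n, g n =ᵐ[P] P[F n | 𝓖] := condExp_midpointSeq_ae_eq hfi heae
  set Y : Ω → Set E := fun ω => closure (Set.range fun n => g n ω)
  have hgY : ∀ n ω, g n ω ∈ Y ω := fun n ω => subset_closure ⟨n, rfl⟩
  have hYsub : ∀ ω {K : Set E}, IsClosed K → Convex ℝ K → (∀ i, e i ω ∈ K) → Y ω ⊆ K := by
    intro ω K hK hKc hKe
    refine hK.closure_subset_iff.2 ?_
    rintro _ ⟨n, rfl⟩
    exact midpointSeq_mem hKc hKe n
  have hYM : ∀ ω, Y ω ⊆ Metric.closedBall (0 : E) |M ω| := fun ω =>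
    hYsub ω Metric.isClosed_closedBall (convex_closedBall _ _) (heM ω)
  have hYc : ∀ ω, IsCompactConvex (Y ω) := fun ω =>
    ⟨⟨_, hgY 0 ω⟩, (isCompact_closedBall _ _).of_isClosed_subset isClosed_closure (hYM ω),
      convex_closure_range_midpointSeq _⟩
  have hYh : HitMeasurable 𝓖 Y := hitMeasurable_closure_range hgm
  have hYm : SetMeasurable 𝓖 Y := hYh.setMeasurable fun ω => (hYc ω).2.1
  -- The upper bound holds because all generators lie in one closed half-space; the lower bound
  -- comes from the generators of index `Nat.pair a k`, which are within `1 / (k + 1)` of the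
  -- maximum.
  have hYs : ∀ a : ℕ, (fun ω => supportFn (Y ω) (v a)) =ᵐ[P]
      P[fun ω => supportFn (X ω) (v a) | 𝓖] := by
    intro a
    have hup : ∀ᵐ ω ∂P, ∀ i, inner ℝ (v a) (e i ω) ≤ P[fun ω => supportFn (X ω) (v a) | 𝓖] ω := by
      refine ae_all_iff.2 fun i => ?_
      filter_upwards [heae i, hupper (f i) (hfsm i) (Filter.Eventually.of_forall (hfX i)) (v a)]
        with ω h1 h2
      rwa [h1]
    have hlow : ∀ᵐ ω ∂P, ∀ k : ℕ, P[fun ω => supportFn (X ω) (v a) | 𝓖] ω ≤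
        inner ℝ (v a) (e (Nat.pair a k) ω) + 1 / ((k : ℝ) + 1) := by
      refine ae_all_iff.2 fun k => ?_
      have hi := (hfi (Nat.pair a k)).const_inner (𝕜 := ℝ) (v a)
      have hle : (fun ω => supportFn (X ω) (v a)) ≤ᵐ[P]
          (fun ω => inner ℝ (v a) (f (Nat.pair a k) ω)) + fun _ => 1 / ((k : ℝ) + 1) := by
        refine Filter.Eventually.of_forall fun ω => ?_
        have := hfs (Nat.pair a k) ω
        simp only [Nat.unpair_pair] at this
        simp only [Pi.add_apply]
        linarith
      have hci : Integrable (fun _ : Ω => 1 / ((k : ℝ) + 1)) P := integrable_const _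
      filter_upwards [heae (Nat.pair a k), condExp_inner_ae_eq (𝓖 := 𝓖) (hfi (Nat.pair a k)) (v a),
        condExp_mono (m := 𝓖) (hsint (v a)) (hi.add hci) hle, condExp_add hi hci 𝓖]
        with ω h1 h2 h3 h4
      rw [h4, Pi.add_apply, condExp_const h𝓖, ← h2] at h3
      rwa [h1]
    filter_upwards [hup, hlow] with ω h1 h2
    apply le_antisymm
    · refine supportFn_le (hYc ω).1 fun y hy => ?_
      exact hYsub ω (K := {y | inner ℝ (v a) y ≤ P[fun ω => supportFn (X ω) (v a) | 𝓖] ω})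
        (isClosed_le (by fun_prop) (by fun_prop))
        (convex_halfSpace_le (innerSL ℝ (v a)).toLinearMap.isLinear _) h1 hy
    · refine le_of_forall_pos_le_add fun ε hε => ?_
      obtain ⟨k, hk⟩ := exists_nat_one_div_lt hε
      have hmem : e (Nat.pair a k) ω ∈ Y ω := by
        obtain ⟨n, hn⟩ := mem_range_midpointSeq (fun i => e i ω) (Nat.pair a k)
        have h3 := hgY n ω
        simp only [hg, hn] at h3
        exact h3
      have h3 := (hYc ω).2.1.inner_le_supportFn (v a) hmem
      have h4 := h2 k
      linarith
  have hgLp : ∀ n, MemLp (g n) 1 (P.trim h𝓖) := fun n =>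
    ((memLp_one_iff_integrable.2 integrable_condExp).ae_eq (hgF n).symm).trim_of_stronglyMeasurable
      h𝓖 (hgm n).stronglyMeasurable
  refine ⟨Y, ⟨hYm, hYc, fun ω => |M ω|, fun ω => abs_nonneg _, ?_, ?_⟩,
    ⟨⟨hXm, fun ω => ⟨(hXc ω).1, (hXc ω).2.1.isClosed⟩, ?_⟩,
      ⟨hYm, fun ω => ⟨(hYc ω).1, (hYc ω).2.1.isClosed⟩, ?_⟩, ?_⟩, hYs⟩
  · exact ((hℓp.condExp hp).trim_of_stronglyMeasurable h𝓖 hMm).abs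
  · exact Filter.Eventually.of_forall fun ω => hausdorffEDist_le_of_norm_le (hYc ω).1
      fun x hx => mem_closedBall_zero_iff.1 (hYM ω hx)
  · exact ⟨_, toLp_mem_selections (memLp_one_iff_integrable.2 (hfi 0))
      (Filter.Eventually.of_forall (hfX 0))⟩
  · exact ⟨_, toLp_mem_selections (hgLp 0) (Filter.Eventually.of_forall (hgY 0))⟩
  apply Set.Subset.antisymm
  · intro G hG
    rw [Metric.mem_closure_iff]
    intro ε hε
    have hGm : StronglyMeasurable[𝓖] G := Lp.stronglyMeasurable G
    -- the index of the first element of the dense family close to `G`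
    have hdm : ∀ n, MeasurableSet[𝓖] {ω | dist (G ω) (g n ω) < ε / 2} := fun n =>
      measurableSet_lt (hGm.measurable.dist (hgm n)) measurable_const
    -- The second alternative makes `Nat.find` defined everywhere; it occurs only on a null set,
    -- where the index is `0`.
    have hex : ∀ ω, ∃ n, dist (G ω) (g n ω) < ε / 2 ∨ ∀ k, ¬ dist (G ω) (g k ω) < ε / 2 := by
      intro ω
      by_cases h : ∃ n, dist (G ω) (g n ω) < ε / 2
      · exact h.imp fun n hn => Or.inl hn
      · exact ⟨0, Or.inr (not_exists.1 h)⟩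
    have hNm : Measurable[𝓖] fun ω => Nat.find (hex ω) := by
      have hall : MeasurableSet[𝓖] {ω | ∀ k, ¬ dist (G ω) (g k ω) < ε / 2} := by
        have : {ω | ∀ k, ¬ dist (G ω) (g k ω) < ε / 2} =
            ⋂ k, {ω | dist (G ω) (g k ω) < ε / 2}ᶜ := by
          ext ω
          simp
        rw [this]
        exact MeasurableSet.iInter fun k => (hdm k).compl
      exact measurable_find hex fun n => (hdm n).union hall
    set N : Ω → ℕ := fun ω => Nat.find (hex ω)
    have hNG : ∀ᵐ ω ∂(P.trim h𝓖), dist (G ω) (g (N ω) ω) < ε / 2 := by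
      filter_upwards [hG] with ω hω
      obtain ⟨k, hk⟩ := Metric.mem_closure_range_iff.1 hω (ε / 2) (half_pos hε)
      exact (Nat.find_spec (hex ω)).resolve_right fun h => h k hk
    have hφm : Measurable[𝓕] fun ω => F (N ω) ω := measurable_apply_nat hFm (hNm.mono h𝓖 le_rfl)
    have hφX : ∀ᵐ ω ∂P, F (N ω) ω ∈ X ω := Filter.Eventually.of_forall fun ω => hFX _ ω
    have hφi := hint _ hφm.aestronglyMeasurable hφX
    have hφLp := memLp_one_iff_integrable.2 hφi
    have hcond : P[fun ω => F (N ω) ω | 𝓖] =ᵐ[P] fun ω => g (N ω) ω := by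
      filter_upwards [condExp_apply_nat_ae_eq hNm hFi hφi, ae_all_iff.2 hgF] with ω h1 h2
      rw [h1, h2]
    have hcondLp : MemLp (P[fun ω => F (N ω) ω | 𝓖]) 1 (P.trim h𝓖) :=
      (memLp_one_iff_integrable.2 integrable_condExp).trim_of_stronglyMeasurable h𝓖
        stronglyMeasurable_condExp
    refine ⟨hcondLp.toLp _, ⟨hφLp.toLp _, toLp_mem_selections hφLp hφX, ?_⟩, ?_⟩
    · exact (ae_eq_of_ae_eq_trim hcondLp.coeFn_toLp).trans
        (condExp_congr_ae hφLp.coeFn_toLp.symm)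
    · have hcond' : P[fun ω => F (N ω) ω | 𝓖] =ᵐ[P.trim h𝓖] fun ω => g (N ω) ω :=
        StronglyMeasurable.ae_eq_trim_of_stronglyMeasurable h𝓖 stronglyMeasurable_condExp
          (measurable_apply_nat hgm hNm).stronglyMeasurable hcond
      have hle : ∀ᵐ ω ∂(P.trim h𝓖), ‖(G - hcondLp.toLp _ : Lp E 1 (P.trim h𝓖)) ω‖ ≤ ε / 2 := by
        filter_upwards [Lp.coeFn_sub G (hcondLp.toLp _), hcondLp.coeFn_toLp, hcond', hNG]
          with ω h1 h2 h3 h4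
        rw [h1, Pi.sub_apply, h2, h3, ← dist_eq_norm]
        exact h4.le
      have := Lp.norm_le_of_ae_bound (half_pos hε).le hle
      -- Total mass one turns the pointwise bound `ε / 2` into the same bound in `L^1`.
      have h1 : measureUnivNNReal (P.trim h𝓖) = 1 := by simp [measureUnivNNReal]
      rw [h1] at this
      simp only [NNReal.coe_one, Real.one_rpow, one_mul] at this
      rw [dist_eq_norm]
      linarith
  -- It remains to see that each `𝔼[φ | 𝓖]` lies in `Y`; countably many half-space inequalities
  -- suffice.
  · refine closure_minimal ?_ (isClosed_selections fun ω => (hYc ω).2.1.isClosed)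
    rintro G ⟨φ, hφ, hGφ⟩
    have hsY : ∀ u, Measurable[𝓖] fun ω => supportFn (Y ω) u :=
      hYh.measurable_supportFn (fun ω => (hYc ω).2.1) (fun ω => (hYc ω).1)
    have hGm : StronglyMeasurable[𝓖] G := Lp.stronglyMeasurable G
    have key : ∀ᵐ ω ∂(P.trim h𝓖), ∀ a, inner ℝ (v a) (G ω) ≤ supportFn (Y ω) (v a) := by
      refine ae_all_iff.2 fun a => ae_trim_of_ae h𝓖 ?_ ?_
      · refine measurableSet_le ?_ (hsY _)
        have := hGm.measurable
        fun_prop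
      · filter_upwards [hGφ, hYs a, hupper φ (Lp.aestronglyMeasurable φ) hφ (v a)] with ω h1 h2 h3
        rw [h1, h2]
        exact h3
    filter_upwards [key] with ω hω
    refine mem_of_forall_inner_le_supportFn (hYc ω) hvd ?_
    rintro _ ⟨a, rfl⟩
    exact hω a

end Existence

/-! ### Hukuhara differences and their conditional expectations -/

section Hukuhara

variable {Ω E : Type*} [NormedAddCommGroup E] [InnerProductSpace ℝ E]

theorem supportFn_singleton_zero (u : E) : supportFn ({0} : Set E) u = 0 := by
  simp [supportFn]

theorem IsHukuharaDiff.supportFn_eq {A B C : Set E} (h : IsHukuharaDiff A B C) (u : E) :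
    supportFn A u = supportFn B u + supportFn C u := by
  obtain ⟨-, hB, hC, rfl⟩ := h
  exact supportFn_add hB.2.1 hB.1 hC.2.1 hC.1 u

/-- Write `x = (y + x) - y` with any `y ∈ B`, so that `y + x ∈ A`. -/
theorem IsHukuharaDiff.norm_le {A B C : Set E} (h : IsHukuharaDiff A B C) {a b : ℝ}
    (ha : ∀ x ∈ A, ‖x‖ ≤ a) (hb : ∀ x ∈ B, ‖x‖ ≤ b) {x : E} (hx : x ∈ C) : ‖x‖ ≤ a + b := by
  obtain ⟨-, ⟨⟨y, hy⟩, -⟩, -, rfl⟩ := h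
  have h1 := ha _ (Set.add_mem_add hy hx)
  have h2 := norm_sub_le (y + x) y
  rw [add_sub_cancel_left] at h2
  linarith [hb y hy]

variable [FiniteDimensional ℝ E]

/-- The pointwise Hukuhara difference of integrably bounded random compact convex sets has a
version which is again one. -/
theorem MemSetLp.exists_hukuharaDiff {m : MeasurableSpace Ω} {μ : Measure Ω} {p : ℝ≥0∞}
    {X₁ X₂ : Ω → Set E} (hX₁ : MemSetLp μ p X₁) (hX₂ : MemSetLp μ p X₂)
    (hex : ∀ᵐ ω ∂μ, HukuharaDiffExists (X₁ ω) (X₂ ω)) :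
    ∃ D : Ω → Set E, MemSetLp μ p D ∧ ∀ᵐ ω ∂μ, IsHukuharaDiff (X₁ ω) (X₂ ω) (D ω) := by
  classical
  obtain ⟨S, hSae, hSm, hS⟩ := hex.exists_measurable_mem
  have hD : ∀ ω, ∃ C : Set E, (ω ∈ S → IsHukuharaDiff (X₁ ω) (X₂ ω) C) ∧ (ω ∉ S → C = {0}) := by
    intro ω
    by_cases hω : ω ∈ S
    · obtain ⟨C, hC⟩ := hS ω hω
      exact ⟨C, fun _ => hC, fun h => absurd hω h⟩
    · exact ⟨{0}, fun h => absurd h hω, fun _ => rfl⟩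
  -- This pointwise choice carries no measurability; it is recovered below from the support
  -- functions, which are explicit on `S` and zero off it.
  choose D hDS hD0 using hD
  have hDae : ∀ᵐ ω ∂μ, IsHukuharaDiff (X₁ ω) (X₂ ω) (D ω) := by
    filter_upwards [hSae] with ω hω
    exact hDS ω hω
  have hDc : ∀ ω, IsCompactConvex (D ω) := by
    intro ω
    by_cases hω : ω ∈ S
    · exact (hDS ω hω).2.2.1
    · rw [hD0 ω hω]
      exact ⟨Set.singleton_nonempty _, isCompact_singleton, convex_singleton _⟩
  have hDs : ∀ u, (fun ω => supportFn (D ω) u) =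
      S.indicator fun ω => supportFn (X₁ ω) u - supportFn (X₂ ω) u := by
    intro u
    ext ω
    by_cases hω : ω ∈ S
    · simp [hω, (hDS ω hω).supportFn_eq u]
    · simp [hω, hD0 ω hω, supportFn_singleton_zero]
  have hDm : ∀ u, Measurable fun ω => supportFn (D ω) u := by
    intro u
    rw [hDs u]
    exact ((hX₁.measurable_supportFn u).sub (hX₂.measurable_supportFn u)).indicator hSm
  obtain ⟨ℓ₁, h01, hℓ₁, hb₁⟩ := hX₁.2.2.exists_norm_le
  obtain ⟨ℓ₂, h02, hℓ₂, hb₂⟩ := hX₂.2.2.exists_norm_le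
  refine ⟨D, ⟨(hitMeasurable_of_measurable_supportFn hDc hDm).setMeasurable fun ω => (hDc ω).2.1,
    hDc, ℓ₁ + ℓ₂, fun ω => add_nonneg (h01 ω) (h02 ω), hℓ₁.add hℓ₂, ?_⟩, hDae⟩
  filter_upwards [hDae, hb₁, hb₂] with ω h h1 h2
  exact hausdorffEDist_le_of_norm_le (hDc ω).1 fun x hx => h.norm_le h1 h2 hx

variable [MeasurableSpace E] [BorelSpace E] {𝓕 𝓖 : MeasurableSpace Ω} {P : Measure[𝓕] Ω}

theorem IsSetCondExp.ae_eq [CompleteSpace E] [IsFiniteMeasure P] {h𝓖 : 𝓖 ≤ 𝓕} {X Y Z : Ω → Set E}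
    (hY : IsSetCondExp P h𝓖 X Y) (hZ : IsSetCondExp P h𝓖 X Z) :
    ∀ᵐ ω ∂(P.trim h𝓖), Y ω = Z ω := by
  have := isFiniteMeasure_trim (μ := P) h𝓖
  have : ProperSpace E := FiniteDimensional.proper ℝ E
  exact hY.2.1.ae_eq_of_selections_eq hZ.2.1 (hY.2.2.trans hZ.2.2.symm)

/-- The set-valued conditional expectation of a Hukuhara difference. -/
theorem IsSetCondExp.isHukuharaDiff [CompleteSpace E] [IsProbabilityMeasure P] {h𝓖 : 𝓖 ≤ 𝓕}
    {p : ℝ≥0∞} (hp : 1 ≤ p) {X₁ X₂ D Y Y₁ Y₂ : Ω → Set E} (hX₁ : MemSetLp P p X₁)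
    (hX₂ : MemSetLp P p X₂) (hD : MemSetLp P p D)
    (hdiff : ∀ᵐ ω ∂P, IsHukuharaDiff (X₁ ω) (X₂ ω) (D ω)) (hY : IsSetCondExp P h𝓖 D Y)
    (hY₁ : IsSetCondExp P h𝓖 X₁ Y₁) (hY₂ : IsSetCondExp P h𝓖 X₂ Y₂) :
    ∀ᵐ ω ∂(P.trim h𝓖), IsHukuharaDiff (Y₁ ω) (Y₂ ω) (Y ω) := by
  have : ProperSpace E := FiniteDimensional.proper ℝ E
  -- The given versions are only known to be closed-valued, so the argument runs on compact convex
  -- versions with known support functions and transfers by uniqueness.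
  obtain ⟨Z, hZ, hDZ, hZs⟩ := hD.exists_isSetCondExp h𝓖 hp
  obtain ⟨Z₁, hZ₁, hXZ₁, hZs₁⟩ := hX₁.exists_isSetCondExp h𝓖 hp
  obtain ⟨Z₂, hZ₂, hXZ₂, hZs₂⟩ := hX₂.exists_isSetCondExp h𝓖 hp
  set v : ℕ → E := TopologicalSpace.denseSeq E
  have key : ∀ᵐ ω ∂(P.trim h𝓖), ∀ a,
      supportFn (Z₁ ω) (v a) = supportFn (Z₂ ω) (v a) + supportFn (Z ω) (v a) := by
    refine ae_all_iff.2 fun a => ae_trim_of_ae h𝓖 (measurableSet_eq_fun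
      (hZ₁.measurable_supportFn _)
      ((hZ₂.measurable_supportFn _).add (hZ.measurable_supportFn _))) ?_
    have heq : (fun ω => supportFn (X₁ ω) (v a)) =ᵐ[P]
        (fun ω => supportFn (X₂ ω) (v a)) + fun ω => supportFn (D ω) (v a) := by
      filter_upwards [hdiff] with ω hω
      exact hω.supportFn_eq _
    filter_upwards [hZs a, hZs₁ a, hZs₂ a, condExp_congr_ae (m := 𝓖) heq,
      condExp_add (hX₂.integrable_supportFn hp (v a)) (hD.integrable_supportFn hp (v a)) 𝓖]
      with ω h h1 h2 h3 h4
    rw [h, h1, h2, h3, h4, Pi.add_apply]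
  filter_upwards [key, hY.ae_eq hDZ, hY₁.ae_eq hXZ₁, hY₂.ae_eq hXZ₂] with ω h h0 h1 h2
  rw [h0, h1, h2]
  have hc := hZ.2.1 ω
  have hc₂ := hZ₂.2.1 ω
  refine ⟨hZ₁.2.1 ω, hc₂, hc, eq_of_supportFn_eq (hZ₁.2.1 ω) (hc₂.add hc)
    (TopologicalSpace.denseRange_denseSeq E) ?_⟩
  rintro _ ⟨a, rfl⟩
  rw [supportFn_add hc₂.2.1 hc₂.1 hc.2.1 hc.1]
  exact h a

end Hukuhara

end SetValued

open SetValued in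
theorem corollary3p1 {Ω : Type*} {𝓕 𝓖 : MeasurableSpace Ω} (P : Measure[𝓕] Ω)
    [IsProbabilityMeasure P] (h𝓖 : 𝓖 ≤ 𝓕) {d : ℕ} {p : ℝ≥0∞} (hp : 1 ≤ p) (hp' : p ≠ ∞)
    (X₁ X₂ : Ω → Set (EuclideanSpace ℝ (Fin d)))
    (hX₁ : MemSetLp P p X₁) (hX₂ : MemSetLp P p X₂)
    (hex : ∀ᵐ ω ∂P, HukuharaDiffExists (X₁ ω) (X₂ ω)) :
    -- `X₁ ⊖ X₂` is an element of `ℒ^p(Ω, 𝒦(ℝ^d))`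
    (∃ D : Ω → Set (EuclideanSpace ℝ (Fin d)),
      MemSetLp P p D ∧ ∀ᵐ ω ∂P, IsHukuharaDiff (X₁ ω) (X₂ ω) (D ω)) ∧
    -- and, for every version `D` of it,
    ∀ D : Ω → Set (EuclideanSpace ℝ (Fin d)), MemSetLp P p D →
      (∀ᵐ ω ∂P, IsHukuharaDiff (X₁ ω) (X₂ ω) (D ω)) →
      -- the conditional expectations exist in `ℒ^p_𝓖(Ω, 𝒦(ℝ^d))`
      (∃ Y, MemSetLp (P.trim h𝓖) p Y ∧ IsSetCondExp P h𝓖 D Y) ∧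
      (∃ Y₁, MemSetLp (P.trim h𝓖) p Y₁ ∧ IsSetCondExp P h𝓖 X₁ Y₁) ∧
      (∃ Y₂, MemSetLp (P.trim h𝓖) p Y₂ ∧ IsSetCondExp P h𝓖 X₂ Y₂) ∧
      -- and `𝔼[X₁ ⊖ X₂ | 𝓖] = 𝔼[X₁ | 𝓖] ⊖ 𝔼[X₂ | 𝓖]` almost surely, for all versions
      ∀ Y Y₁ Y₂ : Ω → Set (EuclideanSpace ℝ (Fin d)),
        IsSetCondExp P h𝓖 D Y → IsSetCondExp P h𝓖 X₁ Y₁ → IsSetCondExp P h𝓖 X₂ Y₂ →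
        ∀ᵐ ω ∂(P.trim h𝓖), IsHukuharaDiff (Y₁ ω) (Y₂ ω) (Y ω) := by
  refine ⟨hX₁.exists_hukuharaDiff hX₂ hex, fun D hD hdiff => ⟨?_, ?_, ?_, ?_⟩⟩
  · obtain ⟨Y, hY, hXY, -⟩ := hD.exists_isSetCondExp h𝓖 hp
    exact ⟨Y, hY, hXY⟩
  · obtain ⟨Y, hY, hXY, -⟩ := hX₁.exists_isSetCondExp h𝓖 hp
    exact ⟨Y, hY, hXY⟩
  · obtain ⟨Y, hY, hXY, -⟩ := hX₂.exists_isSetCondExp h𝓖 hp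
    exact ⟨Y, hY, hXY⟩
  · exact fun Y Y₁ Y₂ hY hY₁ hY₂ => hY.isHukuharaDiff hp hX₁ hX₂ hD hdiff hY₁ hY₂
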